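/- Let $F$ be a finite field with $|F|=q$, let $\mathcal C\subseteq M_n(F)$ be a similarity class, and let $\mu\in F[x]$ be the common minimal polynomial of its elements. Let $m\in F[x]$ be an irreducible factor of $\mu$ of degree $s\ge 1$, let $K$ be a splitting field of $m$ over $F$, let $\alpha\in K$ be a root of $m$, and put $f_\alpha=\mu/(x-\alpha)\in K[x]$. For $A\in\mathcal C$ let $\operatorname{Im} f_\alpha(A)\subseteq K^n$ be the image of the map $v\mapsto f_\alpha(A)v$ on $K^n$. Call $A,B\in\mathcal C$ equivalent if $\operatorname{Im} f_\alpha(A)=\operatorname{Im} f_\alpha(B)$. Then $r=\dim_K\operatorname{Im} f_\alpha(A)$ is the same for all $A\in\mathcal C$, the number of equivalence classes is $$\frac{\prod_{i=1}^{rs}\left(q^n-q^{i-1}\right)}{\prod_{i=1}^{r}\left(q^{rs}-q^{(i-1)s}\right)},$$ and every equivalence class has exactly $$\frac{|\mathcal C|\prod_{i=1}^{r}\left(q^{rs}-q^{(i-1)s}\right)}{\prod_{i=1}^{rs}\left(q^n-q^{i-1}\right)}$$ elements. In particular, if $s=1$ and $a\in F$ is the root of $m$, then, with $K=F$, $f_a=\mu/(x-a)$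 and $r=\dim_F\operatorname{Im} f_a(A)$, the relation $\operatorname{Im} f_a(A)=\operatorname{Im} f_a(B)$ on $\mathcal C$ has $\prod_{i=1}^{r}\frac{q^n-q^{i-1}}{q^r-q^{i-1}}$ equivalence classes, each with $|\mathcal C|\prod_{i=1}^{r}\frac{q^r-q^{i-1}}{q^n-q^{i-1}}$ elements. -/

import Mathlib

open Polynomial

/-- Similar matrices have the same minimal polynomial. -/
theorem minpoly_eq_of_isConj {F : Type*} [Field F] {n : ℕ}
    (A B : Matrix (Fin n) (Fin n) F) (h : IsConj A B) : minpoly F A = minpoly F B := by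
  obtain ⟨c, hc⟩ := h
  let e : Matrix (Fin n) (Fin n) F ≃ₐ[F] Matrix (Fin n) (Fin n) F :=
    AlgEquiv.ofAlgHom
      { toFun := fun M => c * M * (c⁻¹ : _)
        map_one' := by simp
        map_mul' := by intro x y; simp [mul_assoc]
        map_zero' := by simp
        map_add' := by intro x y; simp [mul_add, add_mul]
        commutes' := by
          intro r
          rw [← Algebra.commutes]
          simp [mul_assoc] }
      { toFun := fun M => (c⁻¹ : _) * M * c
        map_one' := by simp
        map_mul' := by intro x y; simp [mul_assoc]
        map_zero' := by simp
        map_add' := by intro x y; simp [mul_add, add_mul]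
        commutes' := by
          intro r
          rw [← Algebra.commutes]
          simp [mul_assoc] }
      (by ext1 x; simp [mul_assoc])
      (by ext1 x; simp [mul_assoc])
  have he : e A = B := by
    change (c : Matrix (Fin n) (Fin n) F) * A * (c⁻¹ : _) = B
    rw [hc.eq, mul_assoc]
    simp
  rw [← he]
  exact (minpoly.algEquiv_eq e A).symm

/-- A similarity class of `n × n` matrices over `F`, that is, a conjugacy class of the
multiplicative monoid of matrices (conjugation by units, i.e. by invertible matrices). -/
abbrev SimilarityClass (n : ℕ) (F : Type*) [Field F] : Type _ :=
  ConjClasses (Matrix (Fin n) (Fin n) F)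

namespace SimilarityClass

/-- The common minimal polynomial `μ` of the elements of a similarity class. -/
noncomputable def minimalPolynomial {n : ℕ} {F : Type*} [Field F]
    (𝒞 : SimilarityClass n F) : F[X] :=
  Quotient.lift (fun A : Matrix (Fin n) (Fin n) F => minpoly F A) minpoly_eq_of_isConj 𝒞

/-- The polynomial `f_α = μ / (x - α)` in `K[x]`, for `α` in an extension `K` of `F`. -/
noncomputable def fRoot {n : ℕ} {F : Type*} [Field F] (𝒞 : SimilarityClass n F)
    {K : Type*} [Field K] [Algebra F K] (α : K) : K[X] :=
  (𝒞.minimalPolynomial.map (algebraMap F K)) /ₘ (X - C α)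

/-- The image `Im f_α(A)`, a subspace of `K ^ n`, of a matrix `A` over `F`. -/
noncomputable def imageSpace {n : ℕ} {F : Type*} [Field F] (𝒞 : SimilarityClass n F)
    {K : Type*} [Field K] [Algebra F K] (α : K) (A : Matrix (Fin n) (Fin n) F) :
    Submodule K (Fin n → K) :=
  LinearMap.range (Matrix.mulVecLin (aeval (A.map (algebraMap F K)) (𝒞.fRoot α)))

/-- The equivalence relation on a similarity class: `A` and `B` are equivalent when
`Im f_α(A) = Im f_α(B)`. -/
noncomputable def imageSetoid {n : ℕ} {F : Type*} [Field F] (𝒞 : SimilarityClass n F)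
    {K : Type*} [Field K] [Algebra F K] (α : K) : Setoid 𝒞.carrier :=
  Setoid.ker fun A : 𝒞.carrier => 𝒞.imageSpace α (A : Matrix (Fin n) (Fin n) F)

end SimilarityClass

/-! Double counting of pairs (image space W, ordered K-basis of W). The columns of `f_α(A)` are
α-eigenvectors of A. A basis of K over F and the trace turn a vector of K^n into s vectors of F^n,
compatibly with matrices over F. Since α generates K and the trace form is nondegenerate, r
independent eigenvectors become rs independent vectors
(`LinearIndependent.traceFamily_of_eigenvector`).

Conversely, GL_n(F) is transitive on independent families of a given size, so any such rs-family
comes from a fixed one by some g, hence from a basis of the image space of gAg⁻¹. The pairs are thus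
in bijection with independent rs-families in F^n (`card_range_imageSpace_mul`). Dividing by the
number of bases of an r-dimensional K-space counts the classes; conjugation shows that they have
equal size (`ncard_eq_of_mem_classes`). -/

/-- Any two linearly independent families with the same index type differ by an invertible
matrix. -/
theorem LinearIndependent.exists_unit_mulVec_eq {F : Type*} [Field F] {n : ℕ} {ι : Type*}
    {u v : ι → Fin n → F} (hu : LinearIndependent F u) (hv : LinearIndependent F v) :
    ∃ g : (Matrix (Fin n) (Fin n) F)ˣ, ∀ i, g.1.mulVec (u i) = v i := by
  obtain ⟨g, hg⟩ := Submodule.exists_linearEquiv_restrict_eq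
    (hu.linearCombinationEquiv.symm.trans hv.linearCombinationEquiv)
  refine ⟨⟨LinearMap.toMatrix' g.toLinearMap, LinearMap.toMatrix' g.symm.toLinearMap,
    by rw [← LinearMap.toMatrix'_comp]; simp, by rw [← LinearMap.toMatrix'_comp]; simp⟩,
    fun i => ?_⟩
  have h1 := hg ⟨u i, Submodule.subset_span ⟨i, rfl⟩⟩
  have h2 : hu.linearCombinationEquiv.symm ⟨u i, Submodule.subset_span ⟨i, rfl⟩⟩ =
      Finsupp.single i 1 := by
    rw [LinearEquiv.symm_apply_eq]
    ext1
    simp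
  rw [LinearEquiv.trans_apply, h2, LinearIndependent.linearCombinationEquiv_apply_coe,
    Finsupp.linearCombination_single, one_smul] at h1
  rw [h1]
  change Matrix.mulVec (LinearMap.toMatrix' (g : (Fin n → F) →ₗ[F] (Fin n → F))) (u i) = _
  rw [LinearMap.toMatrix'_mulVec]
  rfl

/-! ### Trace coordinates: descent from K^n to F^n -/

section TraceCoord

variable {F K : Type*} [Field F] [Field K] [Algebra F K] [FiniteDimensional F K]
  [Algebra.IsSeparable F K] {κ ι : Type*} [Fintype κ] [DecidableEq κ] {n : ℕ}

/-- The coordinates of an element of `K` given by the traces of its products with the elements of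
a basis. -/
noncomputable def traceCoord (b : Module.Basis κ F K) : K ≃ₗ[F] (κ → F) :=
  ((Algebra.traceForm F K).dualBasis (traceForm_nondegenerate F K) b).equivFun

theorem traceCoord_apply (b : Module.Basis κ F K) (x : K) (j : κ) :
    traceCoord b x j = Algebra.trace F K (x * b j) := by
  simp [traceCoord, LinearMap.BilinForm.dualBasis_repr_apply, Algebra.traceForm_apply]

/-- A family of vectors of `K ^ n` corresponds, by trace coordinates, to a family of vectors of
`F ^ n`. -/
noncomputable def traceFamily (b : Module.Basis κ F K) :
    (ι → Fin n → K) ≃ (ι × κ → Fin n → F) where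
  toFun w p k := traceCoord b (w p.1 k) p.2
  invFun v i k := (traceCoord b).symm fun j => v (i, j) k
  left_inv w := by
    funext i k
    exact (traceCoord b).symm_apply_apply (w i k)
  right_inv v := by
    funext p k
    exact congrFun ((traceCoord b).apply_symm_apply fun j => v (p.1, j) k) p.2

theorem traceFamily_apply (b : Module.Basis κ F K) (w : ι → Fin n → K) (p : ι × κ) (k : Fin n) :
    traceFamily b w p k = Algebra.trace F K (w p.1 k * b p.2) :=
  traceCoord_apply b _ _

/-- The trace is F-linear, so entries in F pass through it; this makes the descent
GL_n(F)-equivariant. -/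
theorem traceFamily_mulVec (b : Module.Basis κ F K) (M : Matrix (Fin n) (Fin n) F)
    (w : ι → Fin n → K) (p : ι × κ) :
    traceFamily b (fun i => (M.map (algebraMap F K)).mulVec (w i)) p =
      M.mulVec (traceFamily b w p) := by
  funext k
  simp only [traceFamily_apply, Matrix.mulVec, dotProduct, Matrix.map_apply, Finset.sum_mul,
    map_sum, ← Algebra.smul_def, smul_mul_assoc, map_smul, smul_eq_mul]

/-- Linearly independent eigenvectors in `K ^ n` of a matrix over `F`, for an eigenvalue that
generates `K` over `F`, have linearly independent trace coordinates. -/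
theorem LinearIndependent.traceFamily_of_eigenvector [Fintype ι] (b : Module.Basis κ F K) {α : K}
    (hα : Algebra.adjoin F {α} = ⊤) {A : Matrix (Fin n) (Fin n) F} {w : ι → Fin n → K}
    (hA : ∀ i, (A.map (algebraMap F K)).mulVec (w i) = α • w i) (hw : LinearIndependent K w) :
    LinearIndependent F (traceFamily b w) := by
  -- `Φ c` is the entrywise trace of ∑ c_i w_i. The eigenvector equation makes multiplication of c
  -- by α act on `Φ c` as A.
  let Φ : (ι → K) → Fin n → F := fun c k => ∑ i, Algebra.trace F K (c i * w i k)
  have hΦ (c : ι → K) : Φ (α • c) = A.mulVec (Φ c) := by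
    funext k
    have h (i : ι) : α * w i k = ∑ l, algebraMap F K (A k l) * w i l := by
      have := congrFun (hA i) k
      simpa [Matrix.mulVec, dotProduct] using this.symm
    simp only [Φ, Matrix.mulVec, dotProduct, Finset.mul_sum]
    rw [Finset.sum_comm]
    refine Finset.sum_congr rfl fun i _ => ?_
    have h' : (α • c) i * w i k = ∑ l, A k l • (c i * w i l) := by
      simp only [Pi.smul_apply, smul_eq_mul, Algebra.smul_def]
      rw [mul_comm α, mul_assoc, h, Finset.mul_sum]
      exact Finset.sum_congr rfl fun _ _ => by ring
    rw [h', map_sum]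
    simp
  have hadd (c d : ι → K) : Φ (c + d) = Φ c + Φ d := by
    funext k
    simp [Φ, add_mul, Finset.sum_add_distrib]
  -- The kernel of Φ is stable under F and α, hence under all of K = F[α].
  have hstable (x : K) : ∀ c, Φ c = 0 → Φ (x • c) = 0 := by
    have hx : x ∈ Algebra.adjoin F {α} := hα ▸ Algebra.mem_top
    induction hx using Algebra.adjoin_induction with
    | mem x hx =>
      intro c hc
      rw [Set.mem_singleton_iff.1 hx, hΦ, hc, Matrix.mulVec_zero]
    | algebraMap a =>
      intro c hc
      funext k
      have := congrFun hc k
      simp only [Φ, Pi.zero_apply] at this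
      simp only [Φ, algebraMap_smul, Pi.smul_apply, smul_mul_assoc, map_smul, ← Finset.smul_sum,
        this, smul_zero, Pi.zero_apply]
    | add x y _ _ hx hy =>
      intro c hc
      rw [add_smul, hadd, hx c hc, hy c hc, add_zero]
    | mul x y _ _ hx hy =>
      intro c hc
      rw [mul_smul]
      exact hx _ (hy c hc)
  rw [Fintype.linearIndependent_iff]
  intro g hg
  -- An F-relation among the rs vectors is packed into r coefficients in K, so that it reads `Φ c =
  -- 0`.
  let c : ι → K := fun i => ∑ j, g (i, j) • b j
  have hc : Φ c = 0 := by
    funext k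
    have := congrFun hg k
    simp only [Finset.sum_apply, Pi.smul_apply, traceFamily_apply, Fintype.sum_prod_type] at this
    rw [← this]
    refine Finset.sum_congr rfl fun i _ => ?_
    simp only [c, Finset.sum_mul, map_sum, smul_mul_assoc, map_smul]
    exact Finset.sum_congr rfl fun j _ => by rw [mul_comm]
  have hsum : ∑ i, c i • w i = 0 := by
    funext k
    -- Every K-multiple of the entry has trace zero, so the entry vanishes.
    refine (traceForm_nondegenerate F K).1 _ fun x => ?_
    have := congrFun (hstable x c hc) k
    rw [Algebra.traceForm_apply]
    simp only [Φ, Pi.smul_apply, smul_eq_mul, Pi.zero_apply] at this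
    rw [← this, ← map_sum]
    congr 1
    simp only [Finset.sum_apply, Pi.smul_apply, smul_eq_mul, Finset.sum_mul]
    exact Finset.sum_congr rfl fun j _ => by ring
  have hc0 := Fintype.linearIndependent_iff.1 hw c hsum
  rintro ⟨i, j⟩
  exact Fintype.linearIndependent_iff.1 b.linearIndependent (fun j => g (i, j)) (hc0 i) j

end TraceCoord

/-! ### Counting the fibres of a map -/

theorem Setoid.ncard_classes_ker {X Y : Type*} (f : X → Y) :
    (Setoid.ker f).classes.ncard = Nat.card (Set.range f) := by
  rw [← Nat.card_coe_set_eq]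
  exact Nat.card_congr ((Setoid.quotientEquivClasses _).symm.trans (Setoid.quotientKerEquivRange f))

theorem Setoid.card_eq_ncard_classes_ker_mul {X Y : Type*} [Finite X] (f : X → Y) (N : ℕ)
    (hN : ∀ x, {y | f y = f x}.ncard = N) :
    Nat.card X = (Setoid.ker f).classes.ncard * N := by
  classical
  have := Fintype.ofFinite (Set.range f)
  have e : (Σ W : Set.range f, {x // Set.rangeFactorization f x = W}) ≃ X :=
    Equiv.sigmaFiberEquiv _
  rw [Setoid.ncard_classes_ker, ← Nat.card_congr e, Nat.card_sigma]
  have h (W : Set.range f) : Nat.card {x // Set.rangeFactorization f x = W} = N := by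
    obtain ⟨_, x, rfl⟩ := W
    rw [← hN x, ← Nat.card_coe_set_eq]
    exact Nat.card_congr (Equiv.subtypeEquivRight fun y => by
      simp [Set.rangeFactorization, Subtype.ext_iff])
  simp [h]

/-! ### Conjugation and eigenvectors -/

namespace SimilarityClass

variable {F : Type*} [Field F] {n : ℕ} {K : Type*} [Field K] [Algebra F K]
  (𝒞 : SimilarityClass n F) (α : K)

theorem minimalPolynomial_eq {A : Matrix (Fin n) (Fin n) F} (hA : A ∈ 𝒞.carrier) :
    𝒞.minimalPolynomial = minpoly F A := by
  rw [ConjClasses.mem_carrier_iff_mk_eq] at hA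
  subst hA
  rfl

theorem conj_mem_carrier {A : Matrix (Fin n) (Fin n) F} (hA : A ∈ 𝒞.carrier)
    (g : (Matrix (Fin n) (Fin n) F)ˣ) : g.1 * A * g⁻¹.1 ∈ 𝒞.carrier := by
  rw [ConjClasses.mem_carrier_iff_mk_eq] at hA ⊢
  rw [← hA, ConjClasses.mk_eq_mk_iff_isConj]
  exact IsConj.symm ⟨g, by simp [SemiconjBy, mul_assoc]⟩

theorem exists_conj_eq {A B : Matrix (Fin n) (Fin n) F} (hA : A ∈ 𝒞.carrier)
    (hB : B ∈ 𝒞.carrier) : ∃ g : (Matrix (Fin n) (Fin n) F)ˣ, B = g.1 * A * g⁻¹.1 := by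
  rw [ConjClasses.mem_carrier_iff_mk_eq] at hA hB
  obtain ⟨g, hg⟩ := ConjClasses.mk_eq_mk_iff_isConj.1 (hA.trans hB.symm)
  exact ⟨g, by rw [hg.eq, mul_assoc, Units.mul_inv, mul_one]⟩

/-- An invertible matrix over `F` as a linear automorphism of `K ^ n`. -/
noncomputable def unitEquiv (K : Type*) [Field K] [Algebra F K]
    (g : (Matrix (Fin n) (Fin n) F)ˣ) : (Fin n → K) ≃ₗ[K] (Fin n → K) :=
  LinearEquiv.ofLinearMap (g.1.map (algebraMap F K)).mulVecLin (g⁻¹.1.map (algebraMap F K)).mulVecLin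
    (by rw [← Matrix.mulVecLin_mul, ← Matrix.map_mul]; simp)
    (by rw [← Matrix.mulVecLin_mul, ← Matrix.map_mul]; simp)

theorem unitEquiv_apply (g : (Matrix (Fin n) (Fin n) F)ˣ) (v : Fin n → K) :
    unitEquiv K g v = (g.1.map (algebraMap F K)).mulVec v := rfl

/-- Polynomial evaluation commutes with conjugation, and g⁻¹ is onto, so only the left factor g
moves the image. -/
theorem imageSpace_conj (A : Matrix (Fin n) (Fin n) F) (g : (Matrix (Fin n) (Fin n) F)ˣ) :
    𝒞.imageSpace α (g.1 * A * g⁻¹.1) = (𝒞.imageSpace α A).map (unitEquiv K g).toLinearMap := by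
  let u : (Matrix (Fin n) (Fin n) K)ˣ := Units.map (algebraMap F K).mapMatrix.toMonoidHom g
  have hu : (g.1 * A * g⁻¹.1).map (algebraMap F K) =
      u.1 * A.map (algebraMap F K) * u⁻¹.1 := by
    rw [Matrix.map_mul, Matrix.map_mul]
    rfl
  have hp (p : K[X]) : aeval (u.1 * A.map (algebraMap F K) * u⁻¹.1) p =
      u.1 * aeval (A.map (algebraMap F K)) p * u⁻¹.1 := by
    induction p using Polynomial.induction_on with
    | C a =>
      simp only [aeval_C]
      rw [← Algebra.commutes, mul_assoc, Units.mul_inv, mul_one]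
    | add p q hp hq => simp only [map_add, hp, hq, mul_add, add_mul]
    | monomial k a _ =>
      simp only [map_mul, aeval_C, map_pow, aeval_X]
      rw [Units.conj_pow, ← mul_assoc, ← mul_assoc, ← mul_assoc, Algebra.commutes a u.1]
  rw [imageSpace, imageSpace, hu, hp, Matrix.mulVecLin_mul, Matrix.mulVecLin_mul,
    LinearMap.range_comp_of_range_eq_top, LinearMap.range_comp]
  · rfl
  · exact (unitEquiv K g⁻¹).range

theorem finrank_imageSpace_eq {A B : Matrix (Fin n) (Fin n) F} (hA : A ∈ 𝒞.carrier)
    (hB : B ∈ 𝒞.carrier) :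
    Module.finrank K (𝒞.imageSpace α B) = Module.finrank K (𝒞.imageSpace α A) := by
  obtain ⟨g, rfl⟩ := 𝒞.exists_conj_eq hA hB
  rw [imageSpace_conj]
  exact LinearEquiv.finrank_map_eq _ _

/-- (x - α) f_α = μ annihilates A, so A - α kills the image of f_α(A). -/
theorem mulVec_of_mem_imageSpace (hα : aeval α 𝒞.minimalPolynomial = 0)
    {A : Matrix (Fin n) (Fin n) F} (hA : A ∈ 𝒞.carrier) {v : Fin n → K}
    (hv : v ∈ 𝒞.imageSpace α A) : (A.map (algebraMap F K)).mulVec v = α • v := by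
  obtain ⟨u, rfl⟩ := hv
  have h1 : (X - C α) * 𝒞.fRoot α = 𝒞.minimalPolynomial.map (algebraMap F K) := by
    rw [fRoot, mul_divByMonic_eq_iff_isRoot, IsRoot, eval_map_algebraMap, hα]
  have h2 : aeval (A.map (algebraMap F K)) (𝒞.minimalPolynomial.map (algebraMap F K)) = 0 := by
    rw [aeval_map_algebraMap, 𝒞.minimalPolynomial_eq hA]
    have := aeval_algHom_apply (Algebra.ofId F K).mapMatrix A (minpoly F A)
    rw [minpoly.aeval, map_zero] at this
    exact this
  rw [← h1, map_mul, map_sub, aeval_X, aeval_C] at h2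
  have h3 := congrArg (fun M => Matrix.mulVec M u) h2
  simp only [sub_mul, Matrix.sub_mulVec, ← Matrix.mulVec_mulVec, Matrix.zero_mulVec,
    sub_eq_zero] at h3
  rw [Matrix.mulVecLin_apply, h3, Algebra.algebraMap_eq_smul_one, Matrix.smul_mulVec,
    Matrix.one_mulVec]

/-- All classes of the relation have the same size. -/
theorem ncard_eq_of_mem_classes [Finite F] {E E' : Set 𝒞.carrier}
    (hE : E ∈ (𝒞.imageSetoid α).classes) (hE' : E' ∈ (𝒞.imageSetoid α).classes) :
    E.ncard = E'.ncard := by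
  -- Conjugation by a g that carries x to y injects the class of x into that of y; symmetry gives
  -- equality.
  have key (x y : 𝒞.carrier) : {z | 𝒞.imageSetoid α z x}.ncard ≤
      {z | 𝒞.imageSetoid α z y}.ncard := by
    obtain ⟨g, hg⟩ := 𝒞.exists_conj_eq x.2 y.2
    refine Set.ncard_le_ncard_of_injOn
      (fun z => ⟨g.1 * z.1 * g⁻¹.1, 𝒞.conj_mem_carrier z.2 g⟩) ?_ ?_ (Set.toFinite _)
    · intro z hz
      change 𝒞.imageSpace α (g.1 * z.1 * g⁻¹.1) = 𝒞.imageSpace α y.1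
      rw [hg, imageSpace_conj, imageSpace_conj, show 𝒞.imageSpace α z.1 = _ from hz]
    · intro z _ z' _ h
      have h' : g.1 * z.1 * g⁻¹.1 = g.1 * z'.1 * g⁻¹.1 := Subtype.ext_iff.1 h
      exact Subtype.ext (g.mul_right_inj.1 (g⁻¹.mul_left_inj.1 h'))
  obtain ⟨x, rfl⟩ := hE
  obtain ⟨y, rfl⟩ := hE'
  exact le_antisymm (key x y) (key y x)

theorem ncard_carrier_eq [Finite F] {E : Set 𝒞.carrier} (hE : E ∈ (𝒞.imageSetoid α).classes) :
    𝒞.carrier.ncard = (𝒞.imageSetoid α).classes.ncard * E.ncard := by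
  rw [← Nat.card_coe_set_eq]
  refine Setoid.card_eq_ncard_classes_ker_mul _ _ fun x => ?_
  exact 𝒞.ncard_eq_of_mem_classes α ⟨x, rfl⟩ hE

/-! ### The double count -/

/-- A basis of an image space has linearly independent trace coordinates, and every family with
this property is a basis of an image space. -/
theorem card_range_imageSpace_mul [Finite F] [FiniteDimensional F K]
    (hgen : Algebra.adjoin F {α} = ⊤) (hα : aeval α 𝒞.minimalPolynomial = 0)
    {A : Matrix (Fin n) (Fin n) F} (hA : A ∈ 𝒞.carrier) {r s : ℕ}
    (hr : Module.finrank K (𝒞.imageSpace α A) = r) (b : Module.Basis (Fin s) F K) :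
    (𝒞.imageSetoid α).classes.ncard *
        Nat.card {w : Fin r → 𝒞.imageSpace α A // LinearIndependent K w} =
      Nat.card {v : Fin r × Fin s → Fin n → F // LinearIndependent F v} := by
  have : Finite K := Module.finite_of_finite F
  let f : 𝒞.carrier → Submodule K (Fin n → K) := fun B => 𝒞.imageSpace α B.1
  have hfin (W : Set.range f) : Module.finrank K W.1 = r := by
    obtain ⟨_, B, rfl⟩ := W
    rw [← hr]
    exact 𝒞.finrank_imageSpace_eq α hA B.2
  have hLI (W : Set.range f) (w : Fin r → W.1) (hw : LinearIndependent K w) :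
      LinearIndependent F (traceFamily b fun i => (w i : Fin n → K)) := by
    obtain ⟨_, B, rfl⟩ := W
    refine LinearIndependent.traceFamily_of_eigenvector b hgen (A := B.1) (fun i => ?_)
      (hw.map' (Submodule.subtype _) (Submodule.ker_subtype _))
    exact 𝒞.mulVec_of_mem_imageSpace α hα B.2 (w i).2
  have hspan (W : Set.range f) (w : Fin r → W.1) (hw : LinearIndependent K w) :
      Submodule.span K (Set.range fun i => (w i : Fin n → K)) = W.1 := by
    have h := hw.span_eq_top_of_card_eq_finrank' (by simp [hfin W])
    have h' := congrArg (Submodule.map W.1.subtype) h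
    rwa [Submodule.map_span, Submodule.map_top, Submodule.range_subtype, ← Set.range_comp] at h'
  let Θ : (Σ W : Set.range f, {w : Fin r → W.1 // LinearIndependent K w}) →
      {v : Fin r × Fin s → Fin n → F // LinearIndependent F v} :=
    fun x => ⟨_, hLI x.1 x.2.1 x.2.2⟩
  have hΘ : Function.Bijective Θ := by
    constructor
    -- The vectors of K^n are recovered from their trace coordinates, and W is their span.
    · rintro ⟨W, w, hw⟩ ⟨W', w', hw'⟩ h
      have h' := (traceFamily b).injective (Subtype.ext_iff.1 h)
      have hW : W = W' := by
        rw [Subtype.ext_iff, ← hspan W w hw, ← hspan W' w' hw']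
        exact congrArg (fun t => Submodule.span K (Set.range t)) h'
      subst hW
      have hww : w = w' := funext fun i => Subtype.ext (congrFun h' i)
      subst hww
      rfl
    -- A g carrying the trace family of a fixed basis for A to v yields the required basis for
    -- gAg⁻¹.
    · rintro ⟨v, hv⟩
      let W₀ : Set.range f := ⟨_, ⟨A, hA⟩, rfl⟩
      let w₀ := Module.finBasisOfFinrankEq K W₀.1 (hfin W₀)
      obtain ⟨g, hg⟩ := (hLI W₀ w₀ w₀.linearIndependent).exists_unit_mulVec_eq hv
      refine ⟨⟨⟨_, ⟨_, 𝒞.conj_mem_carrier hA g⟩, rfl⟩, fun i => ⟨unitEquiv K g (w₀ i), ?_⟩, ?_⟩, ?_⟩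
      · change _ ∈ 𝒞.imageSpace α _
        rw [imageSpace_conj]
        exact Submodule.mem_map_of_mem (w₀ i).2
      · refine LinearIndependent.of_comp (Submodule.subtype _) ?_
        exact w₀.linearIndependent.map' ((unitEquiv K g).toLinearMap.comp W₀.1.subtype)
          (LinearMap.ker_eq_bot.2 ((unitEquiv K g).injective.comp Subtype.val_injective))
      · refine Subtype.ext (funext fun p => ?_)
        exact (traceFamily_mulVec b g.1 _ p).trans (hg p)
  have := Fintype.ofFinite (Set.range f)
  have := Fintype.ofFinite K
  rw [← Nat.card_eq_of_bijective Θ hΘ, Nat.card_sigma]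
  have hcard (W : Set.range f) : Nat.card {w : Fin r → W.1 // LinearIndependent K w} =
      Nat.card {w : Fin r → 𝒞.imageSpace α A // LinearIndependent K w} := by
    rw [card_linearIndependent (hfin W).ge, card_linearIndependent hr.ge, hfin W, hr]
  rw [Finset.sum_congr rfl fun W _ => hcard W, Finset.sum_const, smul_eq_mul, Finset.card_univ,
    ← Nat.card_eq_fintype_card]
  congr 1
  exact Setoid.ncard_classes_ker f

theorem cast_card_linearIndependent {K V : Type*} [Field K] [Finite K] [AddCommGroup V]
    [Module K V] [Finite V] {k : ℕ} (hk : k ≤ Module.finrank K V) :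
    (Nat.card {v : Fin k → V // LinearIndependent K v} : ℚ) =
      ∏ i ∈ Finset.Icc 1 k, ((Nat.card K : ℚ) ^ Module.finrank K V - (Nat.card K : ℚ) ^ (i - 1)) := by
  have := Fintype.ofFinite K
  rw [card_linearIndependent hk, Nat.card_eq_fintype_card, Nat.cast_prod,
    ← Finset.Ico_succ_right_eq_Icc, Finset.prod_Ico_eq_prod_range]
  rw [Finset.prod_range]
  refine Finset.prod_congr rfl fun i _ => ?_
  rw [Nat.cast_sub (Nat.pow_le_pow_right Fintype.card_pos (i.2.le.trans hk))]
  simp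

/-- The number and the size of the classes, for an eigenvalue that generates `K` over `F`. -/
theorem classes_card [Finite F] [FiniteDimensional F K]
    (hgen : Algebra.adjoin F {α} = ⊤) (hα : aeval α 𝒞.minimalPolynomial = 0)
    {A : Matrix (Fin n) (Fin n) F} (hA : A ∈ 𝒞.carrier) {q r s : ℕ} (hq : Nat.card F = q)
    (hr : Module.finrank K (𝒞.imageSpace α A) = r) (hs : Module.finrank F K = s) :
    ((𝒞.imageSetoid α).classes.ncard : ℚ) =
      (∏ i ∈ Finset.Icc 1 (r * s), ((q : ℚ) ^ n - (q : ℚ) ^ (i - 1))) /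
        (∏ i ∈ Finset.Icc 1 r, ((q : ℚ) ^ (r * s) - (q : ℚ) ^ ((i - 1) * s))) ∧
    ∀ E ∈ (𝒞.imageSetoid α).classes, (E.ncard : ℚ) = (𝒞.carrier.ncard : ℚ) *
      (∏ i ∈ Finset.Icc 1 r, ((q : ℚ) ^ (r * s) - (q : ℚ) ^ ((i - 1) * s))) /
        (∏ i ∈ Finset.Icc 1 (r * s), ((q : ℚ) ^ n - (q : ℚ) ^ (i - 1))) := by
  have : Finite K := Module.finite_of_finite F
  have hKq : Nat.card K = q ^ s := by rw [← hq, ← hs, Module.natCard_eq_pow_finrank (K := F)]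
  have hspos : 0 < s := hs ▸ Module.finrank_pos
  have hq1 : 1 < q := hq ▸ Finite.one_lt_card
  have hq1' : (1 : ℚ) < q := by exact_mod_cast hq1
  let b := Module.finBasisOfFinrankEq F K hs
  let w₀ := Module.finBasisOfFinrankEq K (𝒞.imageSpace α A) hr
  -- This bound keeps every factor q^n - q^(i-1) nonzero.
  have hle : r * s ≤ n := by
    have h := LinearIndependent.traceFamily_of_eigenvector b hgen (A := A)
      (fun i => 𝒞.mulVec_of_mem_imageSpace α hα hA (w₀ i).2)
      (w₀.linearIndependent.map' (Submodule.subtype _) (Submodule.ker_subtype _))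
    simpa using h.fintype_card_le_finrank
  have hmain := 𝒞.card_range_imageSpace_mul α hgen hα hA hr b
  rw [Nat.card_congr (Equiv.subtypeEquiv (Equiv.arrowCongr finProdFinEquiv (Equiv.refl _))
    (q := fun v : Fin (r * s) → Fin n → F => LinearIndependent F v) fun v =>
      (linearIndependent_equiv finProdFinEquiv.symm (f := v)).symm)] at hmain
  have hmain' := congrArg (Nat.cast : ℕ → ℚ) hmain
  rw [Nat.cast_mul, cast_card_linearIndependent hr.ge,
    cast_card_linearIndependent (by simpa using hle), hr, hKq, hq, Module.finrank_fin_fun] at hmain'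
  simp only [Nat.cast_pow, ← pow_mul, mul_comm s] at hmain'
  have hP : ∏ i ∈ Finset.Icc 1 r, ((q : ℚ) ^ (r * s) - (q : ℚ) ^ ((i - 1) * s)) ≠ 0 := by
    refine Finset.prod_ne_zero_iff.2 fun i hi => ?_
    rw [Finset.mem_Icc] at hi
    exact (sub_pos.2 (pow_lt_pow_right₀ hq1'
      (Nat.mul_lt_mul_of_pos_right (by omega) hspos))).ne'
  have hQ : ∏ i ∈ Finset.Icc 1 (r * s), ((q : ℚ) ^ n - (q : ℚ) ^ (i - 1)) ≠ 0 := by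
    refine Finset.prod_ne_zero_iff.2 fun i hi => ?_
    rw [Finset.mem_Icc] at hi
    exact (sub_pos.2 (pow_lt_pow_right₀ hq1' (by omega))).ne'
  refine ⟨by rw [eq_div_iff hP, hmain'], fun E hE => ?_⟩
  rw [𝒞.ncard_carrier_eq α hE, eq_div_iff hQ, ← hmain', Nat.cast_mul]
  ring

end SimilarityClass

/-! ### The splitting field and the final theorem -/

/-- A root of an irreducible polynomial over a finite field generates the splitting field. -/
theorem adjoin_root_eq_top_of_isSplittingField {F K : Type*} [Field F] [Finite F] [Field K]
    [Algebra F K] {m : F[X]} (hm : Irreducible m) [IsSplittingField F K m] {α : K}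
    (hα : aeval α m = 0) : Algebra.adjoin F {α} = ⊤ := by
  have : FiniteDimensional F K := IsSplittingField.finiteDimensional K m
  have hint : IsIntegral F α := Algebra.IsIntegral.isIntegral α
  have : FiniteDimensional F (IntermediateField.adjoin F {α}) :=
    IntermediateField.adjoin.finiteDimensional hint
  have : Finite (IntermediateField.adjoin F {α}) := Module.finite_of_finite F
  have hroot : aeval (IntermediateField.AdjoinSimple.gen F α) m = 0 := by
    apply (algebraMap (IntermediateField.adjoin F {α}) K).injective
    rw [map_zero, ← aeval_algebraMap_apply, IntermediateField.AdjoinSimple.algebraMap_gen, hα]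
  -- An extension of finite fields is normal, so F(α) already contains all roots of m.
  have hs : (m.map (algebraMap F (IntermediateField.adjoin F {α}))).Splits := by
    have h := Normal.splits (F := F) (K := IntermediateField.adjoin F {α}) inferInstance
      (IntermediateField.AdjoinSimple.gen F α)
    refine h.of_dvd (Polynomial.map_ne_zero (minpoly.ne_zero_of_finite F _)) ?_
    rw [← minpoly.eq_of_irreducible hm hroot, Polynomial.map_mul]
    exact dvd_mul_right _ _
  have h := (IntermediateField.splits_iff_mem (IsSplittingField.splits K m)).1 hs
  rw [eq_top_iff, ← IsSplittingField.adjoin_rootSet K m, Algebra.adjoin_le_iff]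
  intro x hx
  have hx' : x ∈ (IntermediateField.adjoin F {α}).toSubalgebra := h x hx
  rwa [IntermediateField.adjoin_simple_toSubalgebra_of_isAlgebraic hint.isAlgebraic] at hx'

theorem theorem6p3 {F : Type*} [Field F] [Finite F] (q : ℕ) (hq : Nat.card F = q)
    (n : ℕ) (𝒞 : SimilarityClass n F)
    (m : F[X]) (hm : Irreducible m) (hdvd : m ∣ SimilarityClass.minimalPolynomial 𝒞)
    (s : ℕ) (hs : m.natDegree = s)
    {K : Type*} [Field K] [Algebra F K] [Polynomial.IsSplittingField F K m]
    (α : K) (hα : aeval α m = 0)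
    (A : Matrix (Fin n) (Fin n) F) (hA : A ∈ ConjClasses.carrier 𝒞)
    (r : ℕ) (hr : Module.finrank K (SimilarityClass.imageSpace 𝒞 α A) = r) :
    -- the number `r` does not depend on the element of the class
    (∀ B ∈ ConjClasses.carrier 𝒞,
      Module.finrank K (SimilarityClass.imageSpace 𝒞 α B) = r) ∧
    -- the number of equivalence classes
    ((SimilarityClass.imageSetoid 𝒞 α).classes.ncard : ℚ) =
      (∏ i ∈ Finset.Icc 1 (r * s), ((q : ℚ) ^ n - (q : ℚ) ^ (i - 1))) /
        (∏ i ∈ Finset.Icc 1 r, ((q : ℚ) ^ (r * s) - (q : ℚ) ^ ((i - 1) * s))) ∧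
    -- the size of each equivalence class
    (∀ E ∈ (SimilarityClass.imageSetoid 𝒞 α).classes,
      (E.ncard : ℚ) =
        ((ConjClasses.carrier 𝒞).ncard : ℚ) *
          (∏ i ∈ Finset.Icc 1 r, ((q : ℚ) ^ (r * s) - (q : ℚ) ^ ((i - 1) * s))) /
          (∏ i ∈ Finset.Icc 1 (r * s), ((q : ℚ) ^ n - (q : ℚ) ^ (i - 1)))) ∧
    -- the case `s = 1`, where `m = x - a` up to a unit, with image spaces in `F ^ n`
    (s = 1 → ∀ a : F, m.IsRoot a →
      ∀ d : ℕ, Module.finrank F (SimilarityClass.imageSpace 𝒞 a A) = d →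
      ((SimilarityClass.imageSetoid 𝒞 a).classes.ncard : ℚ) =
        ∏ i ∈ Finset.Icc 1 d,
          ((q : ℚ) ^ n - (q : ℚ) ^ (i - 1)) / ((q : ℚ) ^ d - (q : ℚ) ^ (i - 1)) ∧
      ∀ E ∈ (SimilarityClass.imageSetoid 𝒞 a).classes,
        (E.ncard : ℚ) =
          ((ConjClasses.carrier 𝒞).ncard : ℚ) * ∏ i ∈ Finset.Icc 1 d,
            ((q : ℚ) ^ d - (q : ℚ) ^ (i - 1)) / ((q : ℚ) ^ n - (q : ℚ) ^ (i - 1))) := by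
  have : FiniteDimensional F K := IsSplittingField.finiteDimensional K m
  have hgen := adjoin_root_eq_top_of_isSplittingField hm hα
  have hfin : Module.finrank F K = s := by
    have hint : IsIntegral F α := Algebra.IsIntegral.isIntegral α
    have h := IntermediateField.adjoin.finrank hint
    have htop : IntermediateField.adjoin F {α} = ⊤ := by
      rw [← IntermediateField.toSubalgebra_inj, IntermediateField.top_toSubalgebra, ← hgen]
      exact IntermediateField.adjoin_simple_toSubalgebra_of_isAlgebraic hint.isAlgebraic
    rw [htop, IntermediateField.finrank_top', ← minpoly.eq_of_irreducible hm hα,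
      natDegree_mul_C (inv_ne_zero (leadingCoeff_ne_zero.2 hm.ne_zero)), hs] at h
    exact h
  obtain ⟨h1, h2⟩ := 𝒞.classes_card α hgen (aeval_eq_zero_of_dvd_aeval_eq_zero hdvd hα) hA
    hq hr hfin
  refine ⟨fun B hB => hr ▸ 𝒞.finrank_imageSpace_eq α hA hB, h1, h2, fun _ a ha d hd => ?_⟩
  have ha' : aeval a 𝒞.minimalPolynomial = 0 :=
    aeval_eq_zero_of_dvd_aeval_eq_zero hdvd (by rwa [coe_aeval_eq_eval])
  -- The same count with K = F: F has only one subalgebra over itself, so a generates trivially.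
  obtain ⟨h3, h4⟩ := 𝒞.classes_card a (Subsingleton.elim _ _) ha' hA hq hd (Module.finrank_self F)
  simp only [mul_one] at h3 h4
  refine ⟨by rw [h3, Finset.prod_div_distrib], fun E hE => ?_⟩
  rw [h4 E hE, Finset.prod_div_distrib, mul_div_assoc]
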